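/- Consider a restless multi-armed bandit with $N$ arms and discount factor $0\le\beta<1$. Arm $i$ is a two-state (Gilbert–Elliot) Markov chain on $\{0,1\}$ with arbitrary transition probabilities $p_{01}^{(i)},p_{11}^{(i)}\in[0,1]$ (from $0$ to $1$ and from $1$ to $1$) and a reward rate $B_i\ge 0$. Its state is the belief $\omega\in[0,1]$, the conditional probability that the chain is in state $1$. When the arm is activated at belief $\omega$ it yields expected reward $\omega B_i$, and its next belief is $p_{11}^{(i)}$ with probability $\omega$ and $p_{01}^{(i)}$ with probability $1-\omega$. When it is left passive, its next belief is $\mathcal T_i(\omega)=\omega p_{11}^{(i)}+(1-\omega)p_{01}^{(i)}$. For a subsidy $m\in\mathbb R$, collected in each slot in which the arm is passive, let $V^{(i)}_{\beta,m}(\omega)$ be the optimal (over policies mapping beliefs to actions) expected total $\beta$-discounted reward of arm $i$ alone, starting from belief $\omega$, and let $$V^{(i)}_{\beta,m}(\omega;0)=m+\beta V^{(i)}_{\beta,m}(\mathcal T_i(\omega)),\qquad V^{(i)}_{\beta,m}(\omega;1)=\omega B_i+\beta\big(\omega V^{(i)}_{\beta,m}(p_{11}^{(i)})+(1-\omega)V^{(i)}_{\beta,m}(p_{01}^{(i)})\big).$$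 Let $\mathcal P_i(m)=\{\omega\in[0,1]: V^{(i)}_{\beta,m}(\omega;0)\ge V^{(i)}_{\beta,m}(\omega;1)\}$ be the passive set. Theorem. The restless bandit is indexable, that is, every arm $i$ is indexable: as $m$ increases from $-\infty$ to $+\infty$, the passive set increases monotonically from $\emptyset$ to $[0,1]$. Precisely, $\mathcal P_i(m)\subseteq\mathcal P_i(m')$ whenever $m\le m'$, $\mathcal P_i(m)=\emptyset$ for all sufficiently small $m$, and $\mathcal P_i(m)=[0,1]$ for all sufficiently large $m$. -/

import Mathlib

open scoped unitInterval

noncomputable section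

/-- The two actions available for an arm in each slot. -/
inductive ArmAction where
  | passive
  | active

/-- A two-state (Gilbert-Elliot) arm: a Markov chain on the states `0` (bad) and `1` (good) with
transition probabilities `p₀₁ = Pr(0 → 1)` and `p₁₁ = Pr(1 → 1)`, which determine the transition
matrix (`p₀₀ = 1 - p₀₁`, `p₁₀ = 1 - p₁₁`), and a transmission rate `B`, the reward collected when
the arm is activated in the good state. -/
structure GilbertElliotArm where
  p₀₁ : I
  p₁₁ : I
  B : ℝ
  B_nonneg : 0 ≤ B

namespace GilbertElliotArm

variable (a : GilbertElliotArm)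

/-- The one-step belief update of an unobserved arm, `T(ω) = ω p₁₁ + (1 - ω) p₀₁`. -/
def update (ω : I) : I :=
  ⟨(ω : ℝ) * a.p₁₁ + (1 - ω) * a.p₀₁,
    (convex_Icc (0 : ℝ) 1) a.p₁₁.2 a.p₀₁.2 ω.2.1 (sub_nonneg.2 ω.2.2) (by ring)⟩

/-- The conditional expectation of `f` at the next belief state, given the current belief `ω` and
the action. A passive arm moves to `T(ω)`. An active arm is found good with probability `ω`, and
then moves to `p₁₁`, and is found bad with probability `1 - ω`, and then moves to `p₀₁`. -/
def nextExpectation (f : I → ℝ) (ω : I) : ArmAction → ℝ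
  | .passive => f (a.update ω)
  | .active => (ω : ℝ) * f a.p₁₁ + (1 - ω) * f a.p₀₁

/-- The expected one-slot reward at belief `ω` in the arm with subsidy `m` for passivity. -/
def slotReward (m : ℝ) (ω : I) : ArmAction → ℝ
  | .passive => m
  | .active => (ω : ℝ) * a.B

/-- The expected reward `t` slots after the first one, under the policy `π` (a map from belief
states to actions) and initial belief `ω`, by conditioning on the first transition. -/
def expectedReward (m : ℝ) (π : I → ArmAction) : ℕ → I → ℝ
  | 0, ω => a.slotReward m ω (π ω)
  | t + 1, ω => a.nextExpectation (expectedReward m π t) ω (π ω)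

/-- The expected total discounted reward of the policy `π` from the initial belief `ω`. -/
def discountedReward (β m : ℝ) (π : I → ArmAction) (ω : I) : ℝ :=
  ∑' t : ℕ, β ^ t * a.expectedReward m π t ω

/-- The value function `V_{β,m}(ω)`: the optimal expected total discounted reward. -/
def value (β m : ℝ) (ω : I) : ℝ :=
  ⨆ π : I → ArmAction, a.discountedReward β m π ω

/-- `V_{β,m}(ω; u)`: the expected total discounted reward of taking the action `u` in the first
slot and acting optimally afterwards. -/
def actionValue (β m : ℝ) (ω : I) (u : ArmAction) : ℝ :=
  a.slotReward m ω u + β * a.nextExpectation (a.value β m) ω u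

/-- The passive set under subsidy `m`: the beliefs at which being passive is optimal. -/
def passiveSet (β m : ℝ) : Set I :=
  {ω | a.actionValue β m ω .active ≤ a.actionValue β m ω .passive}

/-- An arm is indexable under the discounted reward criterion if its passive set increases
monotonically from `∅` to the whole state space `[0,1]` as the subsidy increases from `-∞`
to `+∞`. -/
def IsIndexable (β : ℝ) : Prop :=
  Monotone (a.passiveSet β) ∧
  (∀ᶠ m in Filter.atBot, a.passiveSet β m = ∅) ∧
  (∀ᶠ m in Filter.atTop, a.passiveSet β m = Set.univ)

end GilbertElliotArm

/-- The data of the restless bandit process `(Ω(1), {Pᵢ}, {Bᵢ}, β)` with `N` Gilbert-Elliot arms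
under the discounted reward criterion. -/
structure GilbertElliotBandit (N : ℕ) where
  initialBelief : Fin N → I
  arm : Fin N → GilbertElliotArm
  β : ℝ
  β_nonneg : 0 ≤ β
  β_lt_one : β < 1

/-- A restless bandit is indexable if every arm is indexable. -/
def GilbertElliotBandit.IsIndexable {N : ℕ} (M : GilbertElliotBandit N) : Prop :=
  ∀ i : Fin N, (M.arm i).IsIndexable M.β

end

namespace GilbertElliotArm

/-! Let `D` be the advantage of passivity. Convexity of the value makes `D` convex. At belief 1 it
equals `m - B`, so for `m < B` the passive set is an initial segment; the ranges `m < 0` and `m ≥ B`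
are trivial. Since the active value is affine in the belief, `D` satisfies the closed recursion
`advantage_eq`. Let `m ≤ m' < B` and let `ω` be passive under `m`. If the orbit of `ω` under the
passive update stays passive, its value is `m / (1 - β)`, and raising the subsidy keeps `ω` passive
(`mem_passiveSet_of_invariant`). Otherwise the orbit has a last passive belief before it exits. If
that belief were active under `m'`, most positive parts in the recursion would vanish, and comparing
`m` with `m'` would give a contradiction. The update is monotone or antitone according to the order
of `p₀₁` and `p₁₁`; this decides which terms survive. -/

/-- A real function that is bounded above, and each of whose nonnegative upper bounds may be
multiplied by `β < 1`, is nonpositive. -/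
lemma nonpos_of_bound_contracts {ι : Type*} {β K : ℝ} (h0 : 0 ≤ β) (h1 : β < 1) {f : ι → ℝ}
    (hK : ∀ i, f i ≤ K) (h : ∀ s, 0 ≤ s → (∀ i, f i ≤ s) → ∀ i, f i ≤ β * s) (i : ι) :
    f i ≤ 0 := by
  have hn : ∀ n : ℕ, ∀ i, f i ≤ β ^ n * |K| := by
    intro n
    induction n with
    | zero => intro i; simpa using (hK i).trans (le_abs_self K)
    | succ n ih =>
      intro i
      have := h _ (by positivity) ih i
      rwa [← mul_assoc, ← pow_succ'] at this
  have ht : Filter.Tendsto (fun n : ℕ => β ^ n * |K|) Filter.atTop (nhds 0) := by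
    simpa using (tendsto_pow_atTop_nhds_zero_of_lt_one h0 h1).mul_const |K|
  exact ge_of_tendsto' ht fun n => hn n i

/-- Convexity of a real function on the unit interval. -/
def IsConvex (f : I → ℝ) : Prop :=
  ∀ x y z : I, ∀ s t : ℝ, 0 ≤ s → 0 ≤ t → s + t = 1 → (z : ℝ) = s * x + t * y →
    f z ≤ s * f x + t * f y

variable (a : GilbertElliotArm)

lemma coe_update (ω : I) : (a.update ω : ℝ) = ω * a.p₁₁ + (1 - ω) * a.p₀₁ := rfl

lemma continuous_update : Continuous a.update := by
  unfold update
  fun_prop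

lemma update_convex_comb {x y z : I} {s t : ℝ} (hst : s + t = 1) (hz : (z : ℝ) = s * x + t * y) :
    (a.update z : ℝ) = s * a.update x + t * a.update y := by
  simp only [coe_update, hz]
  linear_combination -(a.p₀₁ : ℝ) * hst

lemma nextExpectation_le {f g : I → ℝ} {s : ℝ} (h : ∀ ω, f ω ≤ g ω + s) (ω : I) (u : ArmAction) :
    a.nextExpectation f ω u ≤ a.nextExpectation g ω u + s := by
  cases u with
  | passive => exact h _
  | active =>
    have h1 := mul_le_mul_of_nonneg_left (h a.p₁₁) ω.2.1
    have h2 := mul_le_mul_of_nonneg_left (h a.p₀₁) (sub_nonneg.2 ω.2.2)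
    simp only [nextExpectation]
    linarith

lemma abs_nextExpectation_le {f : I → ℝ} {K : ℝ} (h : ∀ ω, |f ω| ≤ K) (ω : I) (u : ArmAction) :
    |a.nextExpectation f ω u| ≤ K := by
  have hz : a.nextExpectation (fun _ => 0) ω u = 0 := by cases u <;> simp [nextExpectation]
  rw [abs_le]
  constructor
  · have h1 := a.nextExpectation_le (f := fun _ => 0) (g := f) (s := K)
      (fun ω => by linarith [(abs_le.1 (h ω)).1]) ω u
    linarith
  · have h1 := a.nextExpectation_le (f := f) (g := fun _ => 0) (s := K)
      (fun ω => by linarith [(abs_le.1 (h ω)).2]) ω u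
    linarith

/-! ### The Bellman operator and its convex fixed point -/

/-- The Bellman operator of the arm with subsidy `m`. -/
noncomputable def bellman (β m : ℝ) (f : C(I, ℝ)) : C(I, ℝ) where
  toFun ω := max (m + β * f (a.update ω))
    ((ω : ℝ) * a.B + β * ((ω : ℝ) * f a.p₁₁ + (1 - ω) * f a.p₀₁))
  continuous_toFun := by
    have := a.continuous_update
    fun_prop

lemma bellman_apply (β m : ℝ) (f : C(I, ℝ)) (ω : I) :
    a.bellman β m f ω = max (a.slotReward m ω .passive + β * a.nextExpectation f ω .passive)
      (a.slotReward m ω .active + β * a.nextExpectation f ω .active) := rfl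

lemma le_bellman (β m : ℝ) (f : C(I, ℝ)) (ω : I) (u : ArmAction) :
    a.slotReward m ω u + β * a.nextExpectation f ω u ≤ a.bellman β m f ω := by
  rw [bellman_apply]
  cases u
  exacts [le_max_left _ _, le_max_right _ _]

lemma bellman_le {β m : ℝ} (h0 : 0 ≤ β) {f g : C(I, ℝ)} {s : ℝ} (h : ∀ ω, f ω ≤ g ω + s) (ω : I) :
    a.bellman β m f ω ≤ a.bellman β m g ω + β * s := by
  have key : ∀ u, a.slotReward m ω u + β * a.nextExpectation f ω u ≤
      a.bellman β m g ω + β * s := fun u => by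
    have h1 := mul_le_mul_of_nonneg_left (a.nextExpectation_le h ω u) h0
    have h2 := a.le_bellman β m g ω u
    linarith
  rw [bellman_apply a β m f]
  exact max_le (key _) (key _)

lemma contractingWith_bellman {β m : ℝ} (h0 : 0 ≤ β) (h1 : β < 1) :
    ContractingWith (⟨β, h0⟩ : NNReal) (a.bellman β m) := by
  refine ⟨by exact_mod_cast h1, LipschitzWith.of_dist_le_mul fun f g => ?_⟩
  have hfg : ∀ ω, |f ω - g ω| ≤ dist f g := fun ω =>
    (Real.dist_eq _ _).symm.le.trans (ContinuousMap.dist_apply_le_dist ω)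
  rw [ContinuousMap.dist_le (by positivity)]
  intro ω
  have hA := a.bellman_le (m := m) h0 (f := f) (g := g) (s := dist f g)
    (fun ω => by linarith [(abs_le.1 (hfg ω)).2]) ω
  have hB := a.bellman_le (m := m) h0 (f := g) (g := f) (s := dist f g)
    (fun ω => by linarith [(abs_le.1 (hfg ω)).1]) ω
  rw [Real.dist_eq, abs_le]
  change -(β * dist f g) ≤ _ ∧ _ ≤ β * dist f g
  constructor <;> linarith

/-- The passive branch is `f` after an affine map, the active branch is affine, and a maximum of
convex functions is convex. -/
lemma isConvex_bellman {β m : ℝ} (h0 : 0 ≤ β) {f : C(I, ℝ)} (hf : IsConvex f) :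
    IsConvex (a.bellman β m f) := by
  intro x y z s t hs ht hst hz
  have hx := fun u => mul_le_mul_of_nonneg_left (a.le_bellman β m f x u) hs
  have hy := fun u => mul_le_mul_of_nonneg_left (a.le_bellman β m f y u) ht
  rw [bellman_apply a β m f z]
  apply max_le
  · have h1 := mul_le_mul_of_nonneg_left
      (hf _ _ _ s t hs ht hst (a.update_convex_comb hst hz)) h0
    have h2 := hx .passive
    have h3 := hy .passive
    simp only [slotReward, nextExpectation] at *
    have h4 : m = (s + t) * m := by rw [hst, one_mul]
    linarith
  · have h2 := hx .active
    have h3 := hy .active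
    simp only [slotReward, nextExpectation, hz] at *
    have h4 : β * f a.p₀₁ = (s + t) * (β * f a.p₀₁) := by rw [hst, one_mul]
    linarith

lemma isClosed_setOf_isConvex : IsClosed {f : C(I, ℝ) | IsConvex f} := by
  simp only [IsConvex, Set.ofPred_forall]
  refine isClosed_iInter fun x => isClosed_iInter fun y => isClosed_iInter fun z =>
    isClosed_iInter fun s => isClosed_iInter fun t => isClosed_iInter fun _ =>
    isClosed_iInter fun _ => isClosed_iInter fun _ => isClosed_iInter fun _ => ?_
  exact isClosed_le (by fun_prop) (by fun_prop)

lemma exists_bellman_fixedPoint {β : ℝ} (m : ℝ) (h0 : 0 ≤ β) (h1 : β < 1) :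
    ∃ W : C(I, ℝ), IsConvex W ∧ a.bellman β m W = W := by
  have hmaps : Set.MapsTo (a.bellman β m) {f | IsConvex f} {f | IsConvex f} :=
    fun f hf => a.isConvex_bellman h0 hf
  have hc := a.contractingWith_bellman (m := m) h0 h1
  obtain ⟨W, hW, hfix, -⟩ := ContractingWith.exists_fixedPoint' (x := 0)
    isClosed_setOf_isConvex.isComplete hmaps (hc.restrict hmaps)
    (by intro x y z s t _ _ _ _; simp) (edist_ne_top _ _)
  exact ⟨W, hW, hfix⟩

/-! ### The value function solves the Bellman equation -/

lemma abs_slotReward_le (m : ℝ) (ω : I) (u : ArmAction) : |a.slotReward m ω u| ≤ |m| + a.B := by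
  have hB := a.B_nonneg
  cases u with
  | passive => simp only [slotReward]; linarith
  | active =>
    have h := mul_le_mul_of_nonneg_right ω.2.2 hB
    simp only [slotReward]
    rw [abs_of_nonneg (mul_nonneg ω.2.1 hB)]
    linarith [abs_nonneg m]

lemma abs_expectedReward_le (m : ℝ) (π : I → ArmAction) (t : ℕ) (ω : I) :
    |a.expectedReward m π t ω| ≤ |m| + a.B := by
  induction t generalizing ω with
  | zero => exact a.abs_slotReward_le m ω _
  | succ t ih => exact a.abs_nextExpectation_le ih ω _

lemma norm_discounted_le {β : ℝ} (h0 : 0 ≤ β) (m : ℝ) (π : I → ArmAction) (ω : I) (t : ℕ) :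
    ‖β ^ t * a.expectedReward m π t ω‖ ≤ β ^ t * (|m| + a.B) := by
  rw [norm_mul, Real.norm_of_nonneg (pow_nonneg h0 t)]
  exact mul_le_mul_of_nonneg_left (a.abs_expectedReward_le m π t ω) (pow_nonneg h0 t)

lemma summable_discounted {β : ℝ} (h0 : 0 ≤ β) (h1 : β < 1) (m : ℝ) (π : I → ArmAction) (ω : I) :
    Summable fun t : ℕ => β ^ t * a.expectedReward m π t ω :=
  Summable.of_norm_bounded ((summable_geometric_of_lt_one h0 h1).mul_right _)
    (a.norm_discounted_le h0 m π ω)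

lemma abs_discountedReward_le {β : ℝ} (h0 : 0 ≤ β) (h1 : β < 1) (m : ℝ) (π : I → ArmAction)
    (ω : I) : |a.discountedReward β m π ω| ≤ (1 - β)⁻¹ * (|m| + a.B) :=
  tsum_of_norm_bounded ((hasSum_geometric_of_lt_one h0 h1).mul_right _)
    (a.norm_discounted_le h0 m π ω)

lemma discountedReward_eq {β : ℝ} (h0 : 0 ≤ β) (h1 : β < 1) (m : ℝ) (π : I → ArmAction) (ω : I) :
    a.discountedReward β m π ω = a.slotReward m ω (π ω) +
      β * a.nextExpectation (a.discountedReward β m π) ω (π ω) := by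
  have hs := a.summable_discounted h0 h1 m π
  rw [discountedReward, (hs ω).tsum_eq_zero_add]
  congr 1
  · simp [expectedReward]
  · simp only [expectedReward, pow_succ', mul_assoc]
    rw [tsum_mul_left]
    congr 1
    cases π ω with
    | passive => rfl
    | active =>
      simp only [nextExpectation, discountedReward]
      rw [← tsum_mul_left, ← tsum_mul_left,
        ← ((hs _).mul_left _).tsum_add ((hs _).mul_left _)]
      exact tsum_congr fun t => by ring

/-- No policy beats `W`, and the policy greedy for `W` attains it; each excess contracts by `β` and
so is nonpositive. -/
lemma value_eq_of_bellman_eq {β m : ℝ} (h0 : 0 ≤ β) (h1 : β < 1) {W : C(I, ℝ)}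
    (hW : a.bellman β m W = W) : a.value β m = W := by
  have hb : ∀ ω, |W ω| ≤ ‖W‖ := W.norm_coe_le_norm
  have hJ := a.abs_discountedReward_le h0 h1 m
  have hle : ∀ π ω, a.discountedReward β m π ω ≤ W ω := by
    intro π ω
    refine sub_nonpos.1 (nonpos_of_bound_contracts h0 h1
      (f := fun ω => a.discountedReward β m π ω - W ω)
      (K := (1 - β)⁻¹ * (|m| + a.B) + ‖W‖) (fun ω => ?_) (fun s _ h ω => ?_) ω)
    · linarith [(abs_le.1 (hJ π ω)).2, (abs_le.1 (hb ω)).1]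
    · have e1 := a.nextExpectation_le (f := a.discountedReward β m π) (g := W) (s := s)
        (fun ω => by linarith [h ω]) ω (π ω)
      have e2 := a.le_bellman β m W ω (π ω)
      rw [hW] at e2
      rw [a.discountedReward_eq h0 h1]
      linarith [mul_le_mul_of_nonneg_left e1 h0]
  have hgreedy : ∀ ω, ∃ u, W ω ≤ a.slotReward m ω u + β * a.nextExpectation W ω u := by
    intro ω
    have e := a.bellman_apply β m W ω
    rw [hW] at e
    rcases max_choice (a.slotReward m ω .passive + β * a.nextExpectation W ω .passive)
      (a.slotReward m ω .active + β * a.nextExpectation W ω .active) with h | h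
    · exact ⟨_, (e.trans h).le⟩
    · exact ⟨_, (e.trans h).le⟩
  choose π hπ using hgreedy
  have hge : ∀ ω, W ω ≤ a.discountedReward β m π ω := by
    intro ω
    refine sub_nonpos.1 (nonpos_of_bound_contracts h0 h1
      (f := fun ω => W ω - a.discountedReward β m π ω)
      (K := (1 - β)⁻¹ * (|m| + a.B) + ‖W‖) (fun ω => ?_) (fun s _ h ω => ?_) ω)
    · linarith [(abs_le.1 (hJ π ω)).1, (abs_le.1 (hb ω)).2]
    · have e1 := a.nextExpectation_le (f := W) (g := a.discountedReward β m π) (s := s)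
        (fun ω => by linarith [h ω]) ω (π ω)
      rw [a.discountedReward_eq h0 h1]
      linarith [mul_le_mul_of_nonneg_left e1 h0, hπ ω]
  funext ω
  have : Nonempty (I → ArmAction) := ⟨π⟩
  exact le_antisymm (ciSup_le fun π => hle π ω)
    ((hge ω).trans (le_ciSup (f := fun π => a.discountedReward β m π ω)
      ⟨W ω, by rintro _ ⟨π, rfl⟩; exact hle π ω⟩ π))

lemma isConvex_value {β : ℝ} (h0 : 0 ≤ β) (h1 : β < 1) (m : ℝ) : IsConvex (a.value β m) := by
  obtain ⟨W, hc, hW⟩ := a.exists_bellman_fixedPoint m h0 h1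
  rwa [a.value_eq_of_bellman_eq h0 h1 hW]

lemma exists_abs_value_le {β : ℝ} (h0 : 0 ≤ β) (h1 : β < 1) (m : ℝ) :
    ∃ K, ∀ ω, |a.value β m ω| ≤ K := by
  obtain ⟨W, hc, hW⟩ := a.exists_bellman_fixedPoint m h0 h1
  rw [a.value_eq_of_bellman_eq h0 h1 hW]
  exact ⟨‖W‖, W.norm_coe_le_norm⟩

/-- The Bellman optimality equation. -/
lemma value_eq_max {β : ℝ} (h0 : 0 ≤ β) (h1 : β < 1) (m : ℝ) (ω : I) :
    a.value β m ω = max (a.actionValue β m ω .passive) (a.actionValue β m ω .active) := by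
  obtain ⟨W, hc, hW⟩ := a.exists_bellman_fixedPoint m h0 h1
  have h := a.bellman_apply β m W ω
  rw [hW] at h
  simpa only [actionValue, a.value_eq_of_bellman_eq h0 h1 hW] using h

lemma actionValue_le_value {β : ℝ} (h0 : 0 ≤ β) (h1 : β < 1) (m : ℝ) (ω : I)
    (u : ArmAction) :
    a.actionValue β m ω u ≤ a.value β m ω := by
  rw [a.value_eq_max h0 h1]
  cases u
  exacts [le_max_left _ _, le_max_right _ _]

lemma actionValue_active (β m : ℝ) (ω : I) : a.actionValue β m ω .active =
    ω * a.B + β * (ω * a.value β m a.p₁₁ + (1 - ω) * a.value β m a.p₀₁) := rfl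

lemma actionValue_passive (β m : ℝ) (ω : I) : a.actionValue β m ω .passive =
    m + β * a.value β m (a.update ω) := rfl

/-! ### Dependence of the value on the subsidy -/

lemma value_le_add {β m m' : ℝ} (h0 : 0 ≤ β) (h1 : β < 1) (hm : m ≤ m') (ω : I) :
    a.value β m' ω ≤ a.value β m ω + (m' - m) / (1 - β) := by
  obtain ⟨K, hK⟩ := a.exists_abs_value_le h0 h1 m
  obtain ⟨K', hK'⟩ := a.exists_abs_value_le h0 h1 m'
  have hd : 0 ≤ (m' - m) / (1 - β) := div_nonneg (by linarith) (by linarith)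
  have hd' : m' - m = (1 - β) * ((m' - m) / (1 - β)) := by
    field_simp [(by linarith : (1 - β) ≠ 0)]
  generalize (m' - m) / (1 - β) = d at hd hd' ⊢
  refine sub_nonpos.1 (nonpos_of_bound_contracts h0 h1
    (f := fun ω => a.value β m' ω - (a.value β m ω + d)) (K := K' + K)
    (fun ω => ?_) (fun s _ h ω => ?_) ω)
  · linarith [(abs_le.1 (hK' ω)).2, (abs_le.1 (hK ω)).1]
  · suffices a.value β m' ω ≤ a.value β m ω + d + β * s by linarith
    have hu : ∀ u, a.actionValue β m' ω u ≤ a.value β m ω + d + β * s := by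
      intro u
      have e1 := mul_le_mul_of_nonneg_left (a.nextExpectation_le (f := a.value β m')
        (g := a.value β m) (s := d + s) (fun ω => by linarith [h ω]) ω u) h0
      have e2 := a.actionValue_le_value h0 h1 m ω u
      have e3 : a.slotReward m' ω u ≤ a.slotReward m ω u + (m' - m) := by
        cases u <;> simp only [slotReward] <;> linarith
      simp only [actionValue] at e2 ⊢
      linarith
    rw [a.value_eq_max h0 h1 m']
    exact max_le (hu _) (hu _)

/-- The bound is the return of staying passive forever. -/
lemma le_value {β : ℝ} (h0 : 0 ≤ β) (h1 : β < 1) (m : ℝ) (ω : I) :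
    m / (1 - β) ≤ a.value β m ω := by
  obtain ⟨K, hK⟩ := a.exists_abs_value_le h0 h1 m
  have hd' : m = (1 - β) * (m / (1 - β)) := by field_simp [(by linarith : (1 - β) ≠ 0)]
  generalize m / (1 - β) = d at hd' ⊢
  refine sub_nonpos.1 (nonpos_of_bound_contracts h0 h1 (f := fun ω => d - a.value β m ω)
    (K := d + K) (fun ω => ?_) (fun s _ h ω => ?_) ω)
  · linarith [(abs_le.1 (hK ω)).1]
  · have e := a.actionValue_le_value h0 h1 m ω .passive
    rw [actionValue_passive] at e
    linarith [mul_le_mul_of_nonneg_left (h (a.update ω)) h0]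

lemma value_eq_passive {β m : ℝ} (h0 : 0 ≤ β) (h1 : β < 1) {ω : I} (h : ω ∈ a.passiveSet β m) :
    a.value β m ω = a.actionValue β m ω .passive := by
  rw [a.value_eq_max h0 h1]
  exact max_eq_left h

/-- A set of beliefs that is invariant under the passive update and contained in the passive set
has value `m / (1 - β)`. -/
lemma value_le_of_invariant {β m : ℝ} (h0 : 0 ≤ β) (h1 : β < 1) {S : Set I}
    (hS : S ⊆ a.passiveSet β m) (hT : Set.MapsTo a.update S S) {ω : I} (hω : ω ∈ S) :
    a.value β m ω ≤ m / (1 - β) := by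
  obtain ⟨K, hK⟩ := a.exists_abs_value_le h0 h1 m
  have hd' : m = (1 - β) * (m / (1 - β)) := by field_simp [(by linarith : (1 - β) ≠ 0)]
  generalize m / (1 - β) = d at hd' ⊢
  refine sub_nonpos.1 (nonpos_of_bound_contracts h0 h1 (f := fun ω : S => a.value β m ω - d)
    (K := K - d) (fun ω => ?_) (fun s _ h ω => ?_) ⟨ω, hω⟩)
  · linarith [(abs_le.1 (hK ω)).2]
  · have e := a.value_eq_passive h0 h1 (hS ω.2)
    rw [actionValue_passive] at e
    have e2 := h ⟨a.update ω, hT ω.2⟩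
    dsimp only at e2
    linarith [mul_le_mul_of_nonneg_left e2 h0]

/-- The active value is at most `m / (1 - β)` under `m` and grows by at most `β (m' - m) / (1 - β)`,
whereas passivity forever gains `(m' - m) / (1 - β)`. -/
lemma mem_passiveSet_of_invariant {β m m' : ℝ} (h0 : 0 ≤ β) (h1 : β < 1) (hm : m ≤ m')
    {S : Set I} (hS : S ⊆ a.passiveSet β m) (hT : Set.MapsTo a.update S S) {ω : I} (hω : ω ∈ S) :
    ω ∈ a.passiveSet β m' := by
  have e1 := a.value_le_of_invariant h0 h1 hS hT hω
  have e2 := a.actionValue_le_value h0 h1 m ω .active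
  have e3 := mul_le_mul_of_nonneg_left (a.nextExpectation_le (a.value_le_add h0 h1 hm) ω .active) h0
  have e4 := mul_le_mul_of_nonneg_left (a.le_value h0 h1 m' (a.update ω)) h0
  have e5 : (m' - m) / (1 - β) + m / (1 - β) = m' / (1 - β) := by rw [← add_div]; ring
  have e6 : β * (m' / (1 - β)) + m' = m' / (1 - β) := by
    field_simp [(by linarith : (1 - β) ≠ 0)]; ring
  have e7 : 0 ≤ (1 - β) * ((m' - m) / (1 - β)) := by
    have : 0 ≤ (m' - m) / (1 - β) := div_nonneg (by linarith) (by linarith)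
    exact mul_nonneg (by linarith) this
  change a.actionValue β m' ω .active ≤ a.actionValue β m' ω .passive
  simp only [actionValue, slotReward, nextExpectation] at *
  linarith

/-! ### The advantage of passivity and the shape of the passive set -/

/-- The advantage of the passive action over the active one. -/
noncomputable def advantage (β m : ℝ) (ω : I) : ℝ :=
  a.actionValue β m ω .passive - a.actionValue β m ω .active

lemma mem_passiveSet_iff {β m : ℝ} {ω : I} : ω ∈ a.passiveSet β m ↔ 0 ≤ a.advantage β m ω := by
  rw [advantage, sub_nonneg]
  rfl

lemma exists_abs_advantage_le {β : ℝ} (h0 : 0 ≤ β) (h1 : β < 1) (m : ℝ) :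
    ∃ K, ∀ ω, |a.advantage β m ω| ≤ K := by
  obtain ⟨K, hK⟩ := a.exists_abs_value_le h0 h1 m
  have hu : ∀ ω u, |a.actionValue β m ω u| ≤ |m| + a.B + β * K := fun ω u => by
    refine (abs_add_le _ _).trans (add_le_add (a.abs_slotReward_le m ω u) ?_)
    rw [abs_mul, abs_of_nonneg h0]
    exact mul_le_mul_of_nonneg_left (a.abs_nextExpectation_le hK ω u) h0
  exact ⟨_, fun ω => (abs_sub _ _).trans (add_le_add (hu ω _) (hu ω _))⟩

lemma isConvex_advantage {β : ℝ} (h0 : 0 ≤ β) (h1 : β < 1) (m : ℝ) :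
    IsConvex (a.advantage β m) := by
  intro x y z s t hs ht hst hz
  have h := mul_le_mul_of_nonneg_left
    (a.isConvex_value h0 h1 m _ _ _ s t hs ht hst (a.update_convex_comb hst hz)) h0
  obtain rfl : t = 1 - s := by linarith
  simp only [advantage, actionValue_active, actionValue_passive, hz]
  linarith

lemma advantage_one (β m : ℝ) : a.advantage β m 1 = m - a.B := by
  have h : a.update 1 = a.p₁₁ := Subtype.ext (by simp [coe_update])
  simp [advantage, actionValue_active, actionValue_passive, h]

lemma value_eq_active_add {β : ℝ} (h0 : 0 ≤ β) (h1 : β < 1) (m : ℝ) (ω : I) :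
    a.value β m ω = a.actionValue β m ω .active + max (a.advantage β m ω) 0 := by
  rw [a.value_eq_max h0 h1, advantage, max_comm, add_comm, ← max_add_add_right]
  simp [max_comm]

/-- The recursion satisfied by the advantage of the passive action. -/
lemma advantage_eq {β : ℝ} (h0 : 0 ≤ β) (h1 : β < 1) (m : ℝ) (ω : I) :
    a.advantage β m ω = m - ω * a.B + β * (max (a.advantage β m (a.update ω)) 0
      - ω * max (a.advantage β m a.p₁₁) 0 - (1 - ω) * max (a.advantage β m a.p₀₁) 0) := by
  have e1 := a.value_eq_active_add h0 h1 m (a.update ω)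
  have e2 := a.value_eq_active_add h0 h1 m a.p₁₁
  have e3 := a.value_eq_active_add h0 h1 m a.p₀₁
  rw [actionValue_active] at e1 e2 e3
  rw [advantage, actionValue_active, actionValue_passive]
  rw [coe_update] at e1
  -- The affine active values cancel along the convex combination `T(ω)` of `p₁₁` and `p₀₁`.
  linear_combination β * e1 - β * ω * e2 - β * (1 - ω) * e3

lemma isConvex_max_zero {f : I → ℝ} (hf : IsConvex f) : IsConvex fun ω => max (f ω) 0 := by
  intro x y z s t hs ht hst hz
  have h := hf x y z s t hs ht hst hz
  have hx := mul_le_mul_of_nonneg_left (le_max_left (f x) 0) hs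
  have hy := mul_le_mul_of_nonneg_left (le_max_left (f y) 0) ht
  have hx' := mul_nonneg hs (le_max_right (f x) 0)
  have hy' := mul_nonneg ht (le_max_right (f y) 0)
  exact max_le (by linarith) (by linarith)

/-- The bracket in `advantage_eq` is nonpositive: it is the convexity gap of the positive part of
the advantage at `T(ω)`. -/
lemma advantage_le {β : ℝ} (h0 : 0 ≤ β) (h1 : β < 1) (m : ℝ) (ω : I) :
    a.advantage β m ω ≤ m - ω * a.B := by
  have h := isConvex_max_zero (a.isConvex_advantage h0 h1 m) a.p₁₁ a.p₀₁ (a.update ω) ω (1 - ω)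
    ω.2.1 (sub_nonneg.2 ω.2.2) (by ring) (a.coe_update ω)
  have h' := mul_le_mul_of_nonneg_left h h0
  rw [a.advantage_eq h0 h1]
  linarith

lemma passiveSet_eq_empty {β m : ℝ} (h0 : 0 ≤ β) (h1 : β < 1) (hm : m < 0) :
    a.passiveSet β m = ∅ := by
  refine Set.eq_empty_of_forall_notMem fun ω hω => ?_
  have e := a.advantage_le h0 h1 m ω
  rw [mem_passiveSet_iff] at hω
  linarith [mul_nonneg ω.2.1 a.B_nonneg]

/-- No slot pays more than `m`, so passivity forever is optimal. -/
lemma passiveSet_eq_univ {β m : ℝ} (h0 : 0 ≤ β) (h1 : β < 1) (hm : a.B ≤ m) :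
    a.passiveSet β m = Set.univ := by
  obtain ⟨K, hK⟩ := a.exists_abs_value_le h0 h1 m
  have hd' : m = (1 - β) * (m / (1 - β)) := by field_simp [(by linarith : (1 - β) ≠ 0)]
  have hlow := a.le_value h0 h1 m
  generalize m / (1 - β) = d at hd' hlow
  have hB : ∀ ω : I, (ω : ℝ) * a.B ≤ m := fun ω =>
    (mul_le_mul_of_nonneg_right ω.2.2 a.B_nonneg).trans (by linarith)
  have hnext : ∀ s, (∀ ω, a.value β m ω ≤ d + s) → ∀ ω u,
      a.actionValue β m ω u ≤ d + β * s := by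
    intro s h ω u
    have e1 := mul_le_mul_of_nonneg_left (a.nextExpectation_le (g := fun _ => d) h ω u) h0
    have e2 : a.nextExpectation (fun _ => d) ω u = d := by
      cases u <;> simp only [nextExpectation]
      ring
    have e3 : a.slotReward m ω u ≤ m := by
      cases u
      exacts [le_rfl, hB ω]
    simp only [actionValue]
    rw [e2] at e1
    linarith
  have hup : ∀ ω, a.value β m ω - d ≤ 0 := by
    refine nonpos_of_bound_contracts h0 h1 (K := K - d) (fun ω => ?_) (fun s _ h ω => ?_)
    · linarith [(abs_le.1 (hK ω)).2]
    · have h' := hnext s (fun ω => by linarith [h ω]) ω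
      rw [a.value_eq_max h0 h1]
      linarith [max_le (h' .passive) (h' .active)]
  refine Set.eq_univ_of_forall fun ω => ?_
  have e1 := hnext 0 (fun ω => by linarith [hup ω]) ω .active
  have e2 := mul_le_mul_of_nonneg_left (hlow (a.update ω)) h0
  change a.actionValue β m ω .active ≤ a.actionValue β m ω .passive
  rw [actionValue_passive]
  linarith

/-- Below the reward rate, the passive set is an initial segment of the beliefs. -/
lemma isLowerSet_passiveSet {β m : ℝ} (h0 : 0 ≤ β) (h1 : β < 1) (hm : m < a.B) :
    IsLowerSet (a.passiveSet β m) := by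
  intro x y hyx hx
  rw [mem_passiveSet_iff] at *
  by_contra! hy
  have hyx' : (y : ℝ) ≤ x := hyx
  have hx1 : (x : ℝ) ≤ 1 := x.2.2
  rcases hyx'.eq_or_lt with h | h
  · rw [Subtype.ext h] at hy
    linarith
  have hd : 0 < 1 - (y : ℝ) := by linarith
  have hs : 0 ≤ (1 - (x : ℝ)) / (1 - y) := div_nonneg (by linarith) hd.le
  have ht : 0 < ((x : ℝ) - y) / (1 - y) := div_pos (by linarith) hd
  -- `x` lies between `y` and 1, where the advantage is negative.
  have hc := a.isConvex_advantage h0 h1 m y 1 x _ _ hs ht.le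
    (by field_simp; ring) (by simp; field_simp; ring)
  rw [advantage_one] at hc
  have e1 := mul_nonpos_of_nonneg_of_nonpos hs hy.le
  have e2 := mul_neg_of_pos_of_neg ht (by linarith : m - a.B < 0)
  linarith

/-! ### Monotonicity in the subsidy below the reward rate -/

lemma coe_update_sub (x y : I) :
    (a.update x : ℝ) - a.update y = ((a.p₁₁ : ℝ) - a.p₀₁) * (x - y) := by
  simp only [coe_update]
  ring

lemma monotone_update (h : a.p₀₁ ≤ a.p₁₁) : Monotone a.update := by
  intro x y hxy
  have h' : (a.p₀₁ : ℝ) ≤ a.p₁₁ := h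
  have hxy' : (x : ℝ) ≤ y := hxy
  have := a.coe_update_sub y x
  have := mul_nonneg (sub_nonneg.2 h') (sub_nonneg.2 hxy')
  exact Subtype.coe_le_coe.1 (by linarith)

lemma antitone_update (h : a.p₁₁ ≤ a.p₀₁) : Antitone a.update := by
  intro x y hxy
  have h' : (a.p₁₁ : ℝ) ≤ a.p₀₁ := h
  have hxy' : (x : ℝ) ≤ y := hxy
  have := a.coe_update_sub y x
  have := mul_nonneg (sub_nonneg.2 h') (sub_nonneg.2 hxy')
  exact Subtype.coe_le_coe.1 (by linarith)

lemma update_zero : a.update 0 = a.p₀₁ := Subtype.ext (by simp [coe_update])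

lemma update_one : a.update 1 = a.p₁₁ := Subtype.ext (by simp [coe_update])

/-- If `u` were active under `m'`, the positive part of the advantage at `p₀₁` would have to grow
with the subsidy, yet the recursion shows that the advantage does not grow anywhere on the passive
set of `m'`. -/
lemma mem_passiveSet_of_update_notMem {β m m' : ℝ} (h0 : 0 ≤ β) (h1 : β < 1) (hm : m ≤ m')
    (hm' : m' < a.B) (hp : a.p₀₁ ≤ a.p₁₁) {u : I} (hu : u ∈ a.passiveSet β m)
    (hTu : a.update u ∉ a.passiveSet β m) : u ∈ a.passiveSet β m' := by
  by_contra hu'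
  have hL := a.isLowerSet_passiveSet h0 h1 (hm.trans_lt hm')
  have hL' := a.isLowerSet_passiveSet h0 h1 hm'
  have hmono := a.monotone_update hp
  have huT : u ≤ a.update u := le_of_not_ge fun h => hTu (hL h hu)
  have hTp : a.update u ≤ a.p₁₁ := by rw [← update_one]; exact hmono u.2.2
  have hp1 : a.p₁₁ ∉ a.passiveSet β m := fun h => hTu (hL hTp h)
  have hTu' : a.update u ∉ a.passiveSet β m' := fun h => hu' (hL' huT h)
  have hp1' : a.p₁₁ ∉ a.passiveSet β m' := fun h => hTu' (hL' hTp h)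
  have hlt : ∀ {ω}, ω ∈ a.passiveSet β m' → ω ≤ u := fun {ω} h =>
    le_of_not_ge fun h' => hu' (hL' h' h)
  have e := a.advantage_eq h0 h1 m
  have e' := a.advantage_eq h0 h1 m'
  have eu := e u
  have eu' := e' u
  simp only [mem_passiveSet_iff, not_le] at hu hu' hTu hTu' hp1 hp1'
  simp only [max_eq_right hp1.le, max_eq_right hp1'.le] at e e' eu eu'
  rw [max_eq_right hTu.le] at eu
  rw [max_eq_right hTu'.le] at eu'
  set y := max (a.advantage β m' a.p₀₁) 0 - max (a.advantage β m a.p₀₁) 0 with hy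
  -- At `u` only the `p₀₁` term of the recursion survives, under both subsidies.
  have hgap : m' - m < β * (1 - u) * y := by rw [hy]; linarith
  have hy0 : 0 < y := by
    by_contra! h
    have := mul_nonneg h0 (sub_nonneg.2 u.2.2)
    linarith [mul_nonpos_of_nonneg_of_nonpos this h]
  obtain ⟨K, hK⟩ := a.exists_abs_advantage_le h0 h1 m
  obtain ⟨K', hK'⟩ := a.exists_abs_advantage_le h0 h1 m'
  have hpsi : ∀ ω : a.passiveSet β m', a.advantage β m' ω - a.advantage β m ω ≤ 0 := by
    refine nonpos_of_bound_contracts h0 h1 (K := K' + K) (fun ω => ?_) (fun s hs h ω => ?_)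
    · linarith [(abs_le.1 (hK' ω)).2, (abs_le.1 (hK ω)).1]
    · have hωu : (ω : ℝ) ≤ u := hlt ω.2
      have hnext : max (a.advantage β m' (a.update ω)) 0
          - max (a.advantage β m (a.update ω)) 0 ≤ s := by
        by_cases hT : a.update ω ∈ a.passiveSet β m'
        · have hs' := h ⟨_, hT⟩
          rw [mem_passiveSet_iff] at hT
          rw [max_eq_left hT]
          dsimp only at hs'
          linarith [le_max_left (a.advantage β m (a.update ω)) 0]
        · rw [mem_passiveSet_iff, not_le] at hT
          rw [max_eq_right hT.le]
          linarith [le_max_right (a.advantage β m (a.update ω)) 0]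
      have e1 := mul_le_mul_of_nonneg_left hnext h0
      -- As `ω ≤ u`, the loss from the `p₀₁` term outweighs the gain `m' - m` at `ω` too.
      have e2 : β * (1 - u) * y ≤ β * (1 - ω) * y :=
        mul_le_mul_of_nonneg_right (mul_le_mul_of_nonneg_left (by linarith) h0) hy0.le
      have e3 : β * (1 - ω) * y = β * (1 - ω) * max (a.advantage β m' a.p₀₁) 0
        - β * (1 - ω) * max (a.advantage β m a.p₀₁) 0 := by rw [hy]; ring
      rw [e' ω, e ω]
      linarith
  by_cases hp0 : a.p₀₁ ∈ a.passiveSet β m'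
  · have h := hpsi ⟨_, hp0⟩
    rw [mem_passiveSet_iff] at hp0
    rw [max_eq_left hp0] at hy
    dsimp only at h
    linarith [le_max_left (a.advantage β m a.p₀₁) 0]
  · rw [mem_passiveSet_iff, not_le] at hp0
    rw [max_eq_right hp0.le] at hy
    linarith [le_max_right (a.advantage β m a.p₀₁) 0]

lemma passiveSet_subset_of_le {β m m' : ℝ} (h0 : 0 ≤ β) (h1 : β < 1) (hm : m ≤ m')
    (hm' : m' < a.B) (hp : a.p₀₁ ≤ a.p₁₁) : a.passiveSet β m ⊆ a.passiveSet β m' := by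
  intro ω hω
  have hL := a.isLowerSet_passiveSet h0 h1 (hm.trans_lt hm')
  have hL' := a.isLowerSet_passiveSet h0 h1 hm'
  have hmono := a.monotone_update hp
  rcases le_total (a.update ω) ω with hd | hd
  · exact a.mem_passiveSet_of_invariant h0 h1 hm (S := Set.Iic ω) (fun x hx => hL hx hω)
      (fun x hx => (hmono hx).trans hd) Set.self_mem_Iic
  by_cases hall : ∀ n, a.update^[n] ω ∈ a.passiveSet β m
  · refine a.mem_passiveSet_of_invariant h0 h1 hm (S := Set.range fun n => a.update^[n] ω)
      (Set.range_subset_iff.2 hall) ?_ ⟨0, rfl⟩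
    rintro _ ⟨n, rfl⟩
    exact ⟨n + 1, Function.iterate_succ_apply' _ _ _⟩
  · push Not at hall
    classical
    obtain ⟨k, hk⟩ : ∃ k, Nat.find hall = k + 1 :=
      Nat.exists_eq_succ_of_ne_zero fun h => Nat.find_spec hall (by rw [h]; exact hω)
    have hout := Nat.find_spec hall
    rw [hk, Function.iterate_succ_apply'] at hout
    have hin := not_not.1 (Nat.find_min hall (m := k) (by omega))
    -- The orbit increases, so `ω` lies below its last belief before the first exit.
    exact hL' (hmono.monotone_iterate_of_le_map hd (Nat.zero_le k))
      (a.mem_passiveSet_of_update_notMem h0 h1 hm hm' hp hin hout)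

lemma passiveSet_subset_of_ge {β m m' : ℝ} (h0 : 0 ≤ β) (h1 : β < 1) (hm : m ≤ m')
    (hm' : m' < a.B) (hp : a.p₁₁ ≤ a.p₀₁) : a.passiveSet β m ⊆ a.passiveSet β m' := by
  intro ω hω
  have hL := a.isLowerSet_passiveSet h0 h1 (hm.trans_lt hm')
  have hL' := a.isLowerSet_passiveSet h0 h1 hm'
  have hanti := a.antitone_update hp
  by_cases hT : a.update ω ∈ a.passiveSet β m
  · have hret : ((a.update (a.update ω) : I) : ℝ) - ω
        = (1 + a.p₁₁ - a.p₀₁) * (a.update ω - ω) := by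
      have := a.coe_update_sub (a.update ω) ω
      linear_combination this
    have hr : (0 : ℝ) ≤ 1 + a.p₁₁ - a.p₀₁ := by linarith [a.p₁₁.2.1, a.p₀₁.2.2]
    rcases le_total ω (a.update ω) with hd | hd
    · refine a.mem_passiveSet_of_invariant h0 h1 hm (S := Set.Icc ω (a.update ω))
        (fun x hx => hL hx.2 hT) (fun x hx => ⟨le_trans ?_ (hanti hx.2), hanti hx.1⟩)
        (Set.left_mem_Icc.2 hd)
      have := mul_nonneg hr (sub_nonneg.2 (Subtype.coe_le_coe.2 hd))
      exact Subtype.coe_le_coe.1 (by linarith)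
    · refine a.mem_passiveSet_of_invariant h0 h1 hm (S := Set.Icc (a.update ω) ω)
        (fun x hx => hL hx.2 hω) (fun x hx => ⟨hanti hx.2, (hanti hx.1).trans ?_⟩)
        (Set.right_mem_Icc.2 hd)
      have := mul_nonneg hr (sub_nonneg.2 (Subtype.coe_le_coe.2 hd))
      exact Subtype.coe_le_coe.1 (by linarith)
  by_contra hω'
  have hTp : a.update ω ≤ a.p₀₁ := by rw [← update_zero]; exact hanti ω.2.1
  have hp0 : a.p₀₁ ∉ a.passiveSet β m := fun h => hT (hL hTp h)
  have hlt : ∀ {x}, x ∈ a.passiveSet β m' → x ≤ ω := fun {x} h =>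
    le_of_not_ge fun h' => hω' (hL' h' h)
  -- With `ω` active under `m'`, the passive set of `m'` lies below `ω`, hence inside that of `m`.
  have hT' : a.update ω ∉ a.passiveSet β m' := fun h => hT (hL (hlt h) hω)
  have hp0' : a.p₀₁ ∉ a.passiveSet β m' := fun h => hp0 (hL (hlt h) hω)
  have e := a.advantage_eq h0 h1 m
  have e' := a.advantage_eq h0 h1 m'
  have hle := a.advantage_le h0 h1 m ω
  by_cases hp1' : a.p₁₁ ∈ a.passiveSet β m'
  · have hp1 := hL (hlt hp1') hω
    have hTT := hanti (hlt hp1')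
    have hTp1 : a.update a.p₁₁ ∉ a.passiveSet β m := fun h => hT (hL hTT h)
    have hTp1' : a.update a.p₁₁ ∉ a.passiveSet β m' := fun h => hT' (hL' hTT h)
    simp only [mem_passiveSet_iff, not_le] at *
    have eω := e ω
    have eω' := e' ω
    have ep := e a.p₁₁
    have ep' := e' a.p₁₁
    rw [max_eq_right hT.le, max_eq_left hp1, max_eq_right hp0.le] at eω
    rw [max_eq_right hT'.le, max_eq_left hp1', max_eq_right hp0'.le] at eω'
    rw [max_eq_right hTp1.le, max_eq_left hp1, max_eq_right hp0.le] at ep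
    rw [max_eq_right hTp1'.le, max_eq_left hp1', max_eq_right hp0'.le] at ep'
    -- Only the `p₁₁` term survives at `ω` and at `p₁₁`. The recursion at `p₁₁` gives `y ≤ m' - m`,
    -- and at `ω` it gives `m' - m < β ω y ≤ y`.
    obtain ⟨y, hy⟩ : ∃ y, y = a.advantage β m' a.p₁₁ - a.advantage β m a.p₁₁ := ⟨_, rfl⟩
    have hgap : m' - m < β * ω * y := by rw [hy]; linarith
    have hyeq : y * (1 + β * a.p₁₁) = m' - m := by rw [hy]; linarith
    have hβp := mul_nonneg h0 a.p₁₁.2.1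
    have hβω : β * ω ≤ 1 := mul_le_one₀ h1.le ω.2.1 ω.2.2
    have hy0 : 0 ≤ y := nonneg_of_mul_nonneg_left (by rw [hyeq]; linarith) (by linarith)
    linarith [mul_nonneg hy0 hβp, mul_le_mul_of_nonneg_right hβω hy0]
  · simp only [mem_passiveSet_iff, not_le] at *
    have eω' := e' ω
    rw [max_eq_right hT'.le, max_eq_right hp1'.le, max_eq_right hp0'.le] at eω'
    linarith

end GilbertElliotArm

theorem theorem1 {N : ℕ} (M : GilbertElliotBandit N) : M.IsIndexable := by
  intro i
  have h0 := M.β_nonneg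
  have h1 := M.β_lt_one
  refine ⟨fun m m' hm => ?_, ?_, ?_⟩
  · rcases le_or_gt (M.arm i).B m' with hB | hB
    · rw [(M.arm i).passiveSet_eq_univ h0 h1 hB]
      exact Set.subset_univ _
    · rcases le_total (M.arm i).p₀₁ (M.arm i).p₁₁ with hp | hp
      · exact (M.arm i).passiveSet_subset_of_le h0 h1 hm hB hp
      · exact (M.arm i).passiveSet_subset_of_ge h0 h1 hm hB hp
  · filter_upwards [Filter.eventually_lt_atBot 0] with m hm
    exact (M.arm i).passiveSet_eq_empty h0 h1 hm
  · filter_upwards [Filter.eventually_ge_atTop (M.arm i).B] with m hm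
    exact (M.arm i).passiveSet_eq_univ h0 h1 hm
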